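/- Let $d$ be a natural number, let $\gamma_d(dx)=\pi^{-d/2}e^{-|x|^2}\,dx$ be the Gaussian measure on $\mathbb{R}^d$, and for $t>0$ let $$T_tf(x)=\frac{1}{\pi^{d/2}(1-e^{-2t})^{d/2}}\int_{\mathbb{R}^d}e^{-\frac{|y-e^{-t}x|^2}{1-e^{-2t}}}f(y)\,dy$$ be the Ornstein--Uhlenbeck semigroup. For $x\in\mathbb{R}^d$ let $$\Gamma^p_\gamma(x)=\Big\{(y,t)\in\mathbb{R}^d\times(0,\infty):\ |y-x|<\min\big(t^{1/2},\tfrac{1}{|x|},1\big)\Big\}$$ be the parabolic Gaussian cone, with the convention $1/|x|=\infty$ for $x=0$. Then for every (real- or complex-valued) $f\in L^1(\gamma_d)$ the following hold. 1. $T_tf\in L^1(\gamma_d)$ for all $t>0$, and $T_tf\to f$ in $L^1(\gamma_d)$ as $t\to0^+$. 2. For almost every $x\in\mathbb{R}^d$, $\displaystyle\lim_{t\to0^+}T_tf(x)=f(x)$. 3. For almost every $x\in\mathbb{R}^d$, $T_tf(y)\to f(x)$ non-tangentially, that is, $\displaystyle\lim_{(y,t)\to(x,0),\ (y,t)\in\Gamma^p_\gamma(x)}T_tf(y)=f(x)$.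 -/

import Mathlib

open MeasureTheory Filter Topology

noncomputable section

/-- The Gaussian measure `γ_d(dx) = π^{-d/2} e^{-|x|²} dx` on `ℝ^d`. -/
def gaussianMeas (d : ℕ) : Measure (EuclideanSpace ℝ (Fin d)) :=
  volume.withDensity fun x =>
    ENNReal.ofReal (Real.exp (-‖x‖ ^ 2) / Real.pi ^ ((d : ℝ) / 2))

/-- The Ornstein-Uhlenbeck semigroup (for `t > 0`)
`T_t f(x) = π^{-d/2} (1 - e^{-2t})^{-d/2} ∫ exp(-|y - e^{-t} x|² / (1 - e^{-2t})) f(y) dy`. -/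
def ornsteinUhlenbeck {𝕜 : Type*} [RCLike 𝕜] {d : ℕ} (t : ℝ)
    (f : EuclideanSpace ℝ (Fin d) → 𝕜) (x : EuclideanSpace ℝ (Fin d)) : 𝕜 :=
  (1 / (Real.pi ^ ((d : ℝ) / 2) * (1 - Real.exp (-2 * t)) ^ ((d : ℝ) / 2))) •
    ∫ y, Real.exp (-‖y - Real.exp (-t) • x‖ ^ 2 / (1 - Real.exp (-2 * t))) • f y

/-- The parabolic Gaussian cone
`{(y, t) : t > 0, |y - x| < t^{1/2} ∧ 1/|x| ∧ 1}`, where `1/|x| = ∞` for `x = 0`. -/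
def parabolicGaussianCone {d : ℕ} (x : EuclideanSpace ℝ (Fin d)) :
    Set (EuclideanSpace ℝ (Fin d) × ℝ) :=
  {p | 0 < p.2 ∧ ‖p.1 - x‖ < Real.sqrt p.2 ∧ (x ≠ 0 → ‖p.1 - x‖ < 1 / ‖x‖) ∧ ‖p.1 - x‖ < 1}

end

open scoped ENNReal

noncomputable section

/-! `T_t` integrates against the Mehler kernel, a probability density in its second variable, and
this kernel is symmetric with respect to `γ_d` (`gaussianDensity_mul_mehlerKernel`). By Tonelli,
`T_t` is therefore a contraction of `L¹(γ_d)`.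

Non-tangential convergence holds at every Lebesgue point `x` of `f`, so no maximal inequality is
needed. Write `T_t f(y) - f(x) = T_t(f - f(x))(y)` and split the integral at `|z - x| = δ`. Near
`x`, the condition `|y - x| < √t` lets a Gaussian centred at `x` of width comparable to `√t`
dominate the kernel (`mehlerKernel_le_near`), and summing over balls reduces to averages of `|f -
f(x)|`. Far from `x`, the kernel is at most `ε` times the Gaussian density
(`eventually_mehlerKernel_le_far`), so integrability against `γ_d` suffices.

The vertical limit is a special case. It gives `L¹` convergence for bounded functions by dominated
convergence, and density with contractivity gives the rest. -/

/-- The density of the Gaussian measure `gaussianMeas d`. -/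
def gaussianDensity {d : ℕ} (x : EuclideanSpace ℝ (Fin d)) : ℝ :=
  Real.exp (-‖x‖ ^ 2) / Real.pi ^ ((d : ℝ) / 2)

/-- The Mehler kernel of the Ornstein-Uhlenbeck semigroup with respect to Lebesgue measure. -/
def mehlerKernel {d : ℕ} (t : ℝ) (x z : EuclideanSpace ℝ (Fin d)) : ℝ :=
  (1 / (Real.pi ^ ((d : ℝ) / 2) * (1 - Real.exp (-2 * t)) ^ ((d : ℝ) / 2))) *
    Real.exp (-‖z - Real.exp (-t) • x‖ ^ 2 / (1 - Real.exp (-2 * t)))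

lemma one_sub_exp_neg_two_mul_pos {t : ℝ} (ht : 0 < t) : 0 < 1 - Real.exp (-2 * t) := by
  have : Real.exp (-2 * t) < 1 := Real.exp_lt_one_iff.mpr (by linarith)
  linarith

lemma exp_neg_sq_eq (t : ℝ) : Real.exp (-t) ^ 2 = Real.exp (-2 * t) := by
  rw [← Real.exp_nat_mul]; congr 1; push_cast; ring

variable {𝕜 : Type*} [RCLike 𝕜] {d : ℕ}

lemma gaussianDensity_pos (x : EuclideanSpace ℝ (Fin d)) : 0 < gaussianDensity x := by
  unfold gaussianDensity; positivity

lemma continuous_gaussianDensity :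
    Continuous (gaussianDensity : EuclideanSpace ℝ (Fin d) → ℝ) := by
  unfold gaussianDensity; fun_prop

lemma mehlerKernel_nonneg {t : ℝ} (ht : 0 < t) (x z : EuclideanSpace ℝ (Fin d)) :
    0 ≤ mehlerKernel t x z := by
  have := one_sub_exp_neg_two_mul_pos ht
  unfold mehlerKernel; positivity

lemma continuous_mehlerKernel (t : ℝ) :
    Continuous fun p : EuclideanSpace ℝ (Fin d) × EuclideanSpace ℝ (Fin d) =>
      mehlerKernel t p.1 p.2 := by
  unfold mehlerKernel; fun_prop

lemma continuous_mehlerKernel_right (t : ℝ) (x : EuclideanSpace ℝ (Fin d)) :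
    Continuous fun z => mehlerKernel t x z := by
  unfold mehlerKernel; fun_prop

lemma ornsteinUhlenbeck_eq_integral (t : ℝ) (f : EuclideanSpace ℝ (Fin d) → 𝕜)
    (x : EuclideanSpace ℝ (Fin d)) :
    ornsteinUhlenbeck t f x = ∫ z, mehlerKernel t x z • f z := by
  unfold ornsteinUhlenbeck mehlerKernel
  rw [← integral_smul]
  simp_rw [mul_smul]

/-! ### Total masses of the Gaussian and of the Mehler kernel. -/

/-- Read off from the known value: a non-integrable function would have integral 0, but the closed
formula is positive. -/
lemma integrable_exp_neg_mul_sq_norm {b : ℝ} (hb : 0 < b) :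
    Integrable fun v : EuclideanSpace ℝ (Fin d) => Real.exp (-b * ‖v‖ ^ 2) := by
  by_contra h
  have h1 := GaussianFourier.integral_rexp_neg_mul_sq_norm (V := EuclideanSpace ℝ (Fin d)) hb
  rw [integral_undef h] at h1
  have : 0 < (Real.pi / b) ^ ((Module.finrank ℝ (EuclideanSpace ℝ (Fin d)) : ℝ) / 2) := by
    positivity
  linarith

lemma integrable_mehlerKernel {t : ℝ} (ht : 0 < t) (x : EuclideanSpace ℝ (Fin d)) :
    Integrable (mehlerKernel t x) := by
  have hs := one_sub_exp_neg_two_mul_pos ht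
  have h := ((integrable_exp_neg_mul_sq_norm (d := d) (inv_pos.2 hs)).comp_sub_right
    (Real.exp (-t) • x)).const_mul
      (1 / (Real.pi ^ ((d : ℝ) / 2) * (1 - Real.exp (-2 * t)) ^ ((d : ℝ) / 2)))
  refine h.congr (ae_of_all _ fun z => ?_)
  simp only [mehlerKernel]
  congr 2; field_simp

lemma integral_mehlerKernel {t : ℝ} (ht : 0 < t) (x : EuclideanSpace ℝ (Fin d)) :
    ∫ z, mehlerKernel t x z = 1 := by
  have hs := one_sub_exp_neg_two_mul_pos ht
  have h : ∀ z, mehlerKernel t x z =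
      (1 / (Real.pi ^ ((d : ℝ) / 2) * (1 - Real.exp (-2 * t)) ^ ((d : ℝ) / 2))) *
      (fun v => Real.exp (-(1 - Real.exp (-2 * t))⁻¹ * ‖v‖ ^ 2)) (z - Real.exp (-t) • x) := by
    intro z
    simp only [mehlerKernel]
    congr 2; field_simp
  simp_rw [h]
  rw [integral_const_mul, integral_sub_right_eq_self
    (fun v : EuclideanSpace ℝ (Fin d) => Real.exp (-(1 - Real.exp (-2 * t))⁻¹ * ‖v‖ ^ 2)),
    GaussianFourier.integral_rexp_neg_mul_sq_norm (inv_pos.2 hs)]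
  rw [finrank_euclideanSpace_fin, div_inv_eq_mul, Real.mul_rpow Real.pi_pos.le hs.le]
  have h1 : 0 < Real.pi ^ ((d : ℝ) / 2) := by positivity
  have h2 : 0 < (1 - Real.exp (-2 * t)) ^ ((d : ℝ) / 2) := by positivity
  rw [one_div_mul_cancel (mul_pos h1 h2).ne']

lemma lintegral_mehlerKernel {t : ℝ} (ht : 0 < t) (x : EuclideanSpace ℝ (Fin d)) :
    ∫⁻ z, ENNReal.ofReal (mehlerKernel t x z) = 1 := by
  rw [← ofReal_integral_eq_lintegral_ofReal (integrable_mehlerKernel ht x)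
    (ae_of_all _ fun z => mehlerKernel_nonneg ht x z), integral_mehlerKernel ht]
  simp

lemma integral_gaussianDensity :
    ∫ x : EuclideanSpace ℝ (Fin d), gaussianDensity x = 1 := by
  have h := GaussianFourier.integral_rexp_neg_mul_sq_norm (V := EuclideanSpace ℝ (Fin d))
    one_pos
  simp only [neg_one_mul, div_one, finrank_euclideanSpace_fin] at h
  simp only [gaussianDensity]
  rw [integral_div, h, div_self]
  positivity

lemma integrable_gaussianDensity :
    Integrable (gaussianDensity : EuclideanSpace ℝ (Fin d) → ℝ) := by
  have h := (integrable_exp_neg_mul_sq_norm (d := d) one_pos).div_const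
    (Real.pi ^ ((d : ℝ) / 2))
  simp only [neg_one_mul] at h
  exact h

instance isProbabilityMeasure_gaussianMeas : IsProbabilityMeasure (gaussianMeas d) := by
  constructor
  change (volume.withDensity fun x => ENNReal.ofReal (gaussianDensity x)) Set.univ = 1
  rw [withDensity_apply _ MeasurableSet.univ, Measure.restrict_univ,
    ← ofReal_integral_eq_lintegral_ofReal integrable_gaussianDensity
    (ae_of_all _ fun z => (gaussianDensity_pos z).le), integral_gaussianDensity]
  simp

/-! ### Symmetry of the kernel and comparison of `γ_d` with Lebesgue measure. -/

/-- The Mehler kernel with respect to the Gaussian density. -/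
lemma mehlerKernel_eq_mul_exp {t : ℝ} (ht : 0 < t) (x z : EuclideanSpace ℝ (Fin d)) :
    mehlerKernel t x z = Real.exp (‖x‖ ^ 2) * Real.exp (-‖z‖ ^ 2) * mehlerKernel t z x := by
  have hs := one_sub_exp_neg_two_mul_pos ht
  -- With `a = e^{-t}`, `|z - ax|² - |x - az|² = (1 - a²)(|z|² - |x|²)`.
  have hn : -‖z - Real.exp (-t) • x‖ ^ 2 / (1 - Real.exp (-2 * t)) =
      ‖x‖ ^ 2 + (-‖z‖ ^ 2) + -‖x - Real.exp (-t) • z‖ ^ 2 / (1 - Real.exp (-2 * t)) := by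
    rw [norm_sub_sq_real, norm_sub_sq_real, norm_smul, norm_smul, inner_smul_right,
      inner_smul_right, real_inner_comm, mul_pow, mul_pow, Real.norm_eq_abs, sq_abs,
      exp_neg_sq_eq]
    generalize Real.exp (-2 * t) = u at *
    field_simp
    ring
  unfold mehlerKernel
  rw [hn, Real.exp_add, Real.exp_add]
  ring

lemma gaussianDensity_mul_mehlerKernel {t : ℝ} (ht : 0 < t) (x z : EuclideanSpace ℝ (Fin d)) :
    gaussianDensity x * mehlerKernel t x z = gaussianDensity z * mehlerKernel t z x := by
  rw [mehlerKernel_eq_mul_exp ht x z]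
  unfold gaussianDensity
  have : Real.exp (-‖x‖ ^ 2) * Real.exp (‖x‖ ^ 2) = 1 := by
    rw [← Real.exp_add]; simp
  linear_combination (Real.exp (-‖z‖ ^ 2) * mehlerKernel t z x / Real.pi ^ ((d : ℝ) / 2)) * this

lemma lintegral_gaussianMeas {g : EuclideanSpace ℝ (Fin d) → ℝ≥0∞} :
    ∫⁻ x, g x ∂(gaussianMeas d) = ∫⁻ x, ENNReal.ofReal (gaussianDensity x) * g x := by
  change ∫⁻ x, g x ∂(volume.withDensity fun x => ENNReal.ofReal (gaussianDensity x)) = _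
  rw [lintegral_withDensity_eq_lintegral_mul_non_measurable]
  · rfl
  · exact continuous_gaussianDensity.measurable.ennreal_ofReal
  · exact ae_of_all _ fun x => ENNReal.ofReal_lt_top

lemma gaussianMeas_absolutelyContinuous : gaussianMeas d ≪ volume :=
  withDensity_absolutelyContinuous _ _

lemma volume_absolutelyContinuous_gaussianMeas :
    (volume : Measure (EuclideanSpace ℝ (Fin d))) ≪ gaussianMeas d := by
  refine withDensity_absolutelyContinuous'
    (continuous_gaussianDensity.measurable.ennreal_ofReal).aemeasurable ?_
  exact ae_of_all _ fun x => (ENNReal.ofReal_pos.2 (gaussianDensity_pos x)).ne'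

lemma integrable_gaussianMeas_iff {f : EuclideanSpace ℝ (Fin d) → 𝕜} :
    Integrable f (gaussianMeas d) ↔ Integrable fun x => gaussianDensity x • f x := by
  change Integrable f (volume.withDensity fun x => ENNReal.ofReal (gaussianDensity x)) ↔ _
  rw [integrable_withDensity_iff_integrable_smul'
    continuous_gaussianDensity.measurable.ennreal_ofReal
    (ae_of_all _ fun x => ENNReal.ofReal_lt_top)]
  simp_rw [ENNReal.toReal_ofReal (gaussianDensity_pos _).le]

lemma aestronglyMeasurable_volume {f : EuclideanSpace ℝ (Fin d) → 𝕜}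
    (hf : Integrable f (gaussianMeas d)) : AEStronglyMeasurable f volume :=
  hf.1.mono_ac volume_absolutelyContinuous_gaussianMeas

/-- The density is continuous and never zero, so dividing by it keeps local integrability. This
opens the way to Lebesgue differentiation. -/
lemma locallyIntegrable_of_integrable_gaussianMeas {f : EuclideanSpace ℝ (Fin d) → 𝕜}
    (hf : Integrable f (gaussianMeas d)) : LocallyIntegrable f volume := by
  have h := (integrable_gaussianMeas_iff.1 hf).locallyIntegrable.continuous_smul
    (continuous_gaussianDensity.inv₀ fun x => (gaussianDensity_pos x).ne')
  simpa only [Pi.inv_apply, inv_smul_smul₀ (gaussianDensity_pos _).ne'] using h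

/-- The Mehler kernel is bounded by a multiple of the Gaussian density in its second variable. -/
lemma exists_mehlerKernel_le {t : ℝ} (ht : 0 < t) (x : EuclideanSpace ℝ (Fin d)) :
    ∃ C : ℝ, ∀ z, mehlerKernel t x z ≤ C * gaussianDensity z := by
  have hs := one_sub_exp_neg_two_mul_pos ht
  -- Exchanging the variables brings out `e^{-|z|²}`; what remains is at most the normalising
  -- constant, whose `π^{-d/2}` goes into the density.
  refine ⟨Real.exp (‖x‖ ^ 2) * (1 / (1 - Real.exp (-2 * t)) ^ ((d : ℝ) / 2)), fun z => ?_⟩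
  have h1 : mehlerKernel t z x ≤
      1 / (Real.pi ^ ((d : ℝ) / 2) * (1 - Real.exp (-2 * t)) ^ ((d : ℝ) / 2)) := by
    refine mul_le_of_le_one_right (by positivity) (Real.exp_le_one_iff.2 ?_)
    rw [neg_div]; exact neg_nonpos.2 (by positivity)
  rw [mehlerKernel_eq_mul_exp ht]
  calc _ ≤ _ := mul_le_mul_of_nonneg_left h1 (by positivity)
    _ = _ := by
      unfold gaussianDensity
      have : 0 < Real.pi ^ ((d : ℝ) / 2) := by positivity
      field_simp

/-! ### The semigroup on `L¹(γ_d)`. -/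

lemma integrable_mehlerKernel_smul {t : ℝ} (ht : 0 < t) (x : EuclideanSpace ℝ (Fin d))
    {f : EuclideanSpace ℝ (Fin d) → 𝕜} (hf : Integrable f (gaussianMeas d)) :
    Integrable fun z => mehlerKernel t x z • f z := by
  obtain ⟨C, hC⟩ := exists_mehlerKernel_le ht x
  refine ((integrable_gaussianMeas_iff.1 hf).norm.const_mul C).mono' ?_ (ae_of_all _ fun z => ?_)
  · exact ((integrable_mehlerKernel ht x).1).smul (aestronglyMeasurable_volume hf)
  · rw [norm_smul, norm_smul, Real.norm_of_nonneg (mehlerKernel_nonneg ht x z),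
      Real.norm_of_nonneg (gaussianDensity_pos z).le, ← mul_assoc]
    exact mul_le_mul_of_nonneg_right (hC z) (norm_nonneg _)

lemma ornsteinUhlenbeck_sub {t : ℝ} (ht : 0 < t) {f g : EuclideanSpace ℝ (Fin d) → 𝕜}
    (hf : Integrable f (gaussianMeas d)) (hg : Integrable g (gaussianMeas d)) :
    ornsteinUhlenbeck t (f - g) = ornsteinUhlenbeck t f - ornsteinUhlenbeck t g := by
  ext x
  simp only [ornsteinUhlenbeck_eq_integral, Pi.sub_apply, smul_sub]
  exact integral_sub (integrable_mehlerKernel_smul ht x hf) (integrable_mehlerKernel_smul ht x hg)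

lemma ornsteinUhlenbeck_const {t : ℝ} (ht : 0 < t) (c : 𝕜) (x : EuclideanSpace ℝ (Fin d)) :
    ornsteinUhlenbeck t (fun _ => c) x = c := by
  rw [ornsteinUhlenbeck_eq_integral, integral_smul_const, integral_mehlerKernel ht, one_smul]

lemma enorm_ornsteinUhlenbeck_le {t : ℝ} (ht : 0 < t) (f : EuclideanSpace ℝ (Fin d) → 𝕜)
    (x : EuclideanSpace ℝ (Fin d)) :
    ‖ornsteinUhlenbeck t f x‖ₑ ≤ ∫⁻ z, ENNReal.ofReal (mehlerKernel t x z) * ‖f z‖ₑ := by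
  rw [ornsteinUhlenbeck_eq_integral]
  refine (enorm_integral_le_lintegral_enorm _).trans_eq (lintegral_congr fun z => ?_)
  rw [enorm_smul, Real.enorm_eq_ofReal (mehlerKernel_nonneg ht x z)]

lemma aestronglyMeasurable_ornsteinUhlenbeck (t : ℝ) {f : EuclideanSpace ℝ (Fin d) → 𝕜}
    (hf : Integrable f (gaussianMeas d)) :
    AEStronglyMeasurable (ornsteinUhlenbeck t f) (gaussianMeas d) := by
  refine AEStronglyMeasurable.mono_ac gaussianMeas_absolutelyContinuous ?_
  have h : AEStronglyMeasurable (fun p : EuclideanSpace ℝ (Fin d) × EuclideanSpace ℝ (Fin d) =>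
      mehlerKernel t p.1 p.2 • f p.2) (volume.prod volume) :=
    (continuous_mehlerKernel t).aestronglyMeasurable.smul (aestronglyMeasurable_volume hf).comp_snd
  have := h.integral_prod_right'
  exact this.congr (ae_of_all _ fun x => (ornsteinUhlenbeck_eq_integral t f x).symm)

/-- The Ornstein-Uhlenbeck semigroup is a contraction on `L¹` of the Gaussian measure. -/
lemma lintegral_enorm_ornsteinUhlenbeck_le {t : ℝ} (ht : 0 < t)
    {f : EuclideanSpace ℝ (Fin d) → 𝕜} (hf : Integrable f (gaussianMeas d)) :
    ∫⁻ x, ‖ornsteinUhlenbeck t f x‖ₑ ∂(gaussianMeas d) ≤ ∫⁻ x, ‖f x‖ₑ ∂(gaussianMeas d) := by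
  have hK : Measurable fun p : EuclideanSpace ℝ (Fin d) × EuclideanSpace ℝ (Fin d) =>
      ENNReal.ofReal (mehlerKernel t p.1 p.2) := (continuous_mehlerKernel t).measurable.ennreal_ofReal
  have hw : Measurable fun x : EuclideanSpace ℝ (Fin d) => ENNReal.ofReal (gaussianDensity x) :=
    continuous_gaussianDensity.measurable.ennreal_ofReal
  have hfm := (aestronglyMeasurable_volume hf).enorm
  rw [lintegral_gaussianMeas, lintegral_gaussianMeas]
  calc ∫⁻ x, ENNReal.ofReal (gaussianDensity x) * ‖ornsteinUhlenbeck t f x‖ₑ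
      ≤ ∫⁻ x, ∫⁻ z, ENNReal.ofReal (gaussianDensity x) *
          (ENNReal.ofReal (mehlerKernel t x z) * ‖f z‖ₑ) := by
        refine lintegral_mono fun x => ?_
        rw [lintegral_const_mul' _ _ ENNReal.ofReal_ne_top]
        gcongr
        exact enorm_ornsteinUhlenbeck_le ht f x
    _ = ∫⁻ z, ∫⁻ x, ENNReal.ofReal (gaussianDensity x) *
          (ENNReal.ofReal (mehlerKernel t x z) * ‖f z‖ₑ) := by
        refine lintegral_lintegral_swap ?_
        exact (hw.comp measurable_fst).aemeasurable.mul (hK.aemeasurable.mul hfm.comp_snd)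
    _ = ∫⁻ z, ENNReal.ofReal (gaussianDensity z) * ‖f z‖ₑ := by
        -- Symmetry turns the integral in `x` into the total mass of `mehlerKernel t z`.
        refine lintegral_congr fun z => ?_
        calc ∫⁻ x, ENNReal.ofReal (gaussianDensity x) *
              (ENNReal.ofReal (mehlerKernel t x z) * ‖f z‖ₑ)
            = ∫⁻ x, ENNReal.ofReal (mehlerKernel t z x) *
              (ENNReal.ofReal (gaussianDensity z) * ‖f z‖ₑ) := by
              refine lintegral_congr fun x => ?_
              rw [← mul_assoc, ← mul_assoc, ← ENNReal.ofReal_mul (gaussianDensity_pos x).le,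
                gaussianDensity_mul_mehlerKernel ht, ENNReal.ofReal_mul (gaussianDensity_pos z).le,
                mul_comm (ENNReal.ofReal (gaussianDensity z))]
          _ = _ := by
              have hKz : Measurable fun x => ENNReal.ofReal (mehlerKernel t z x) :=
                (continuous_mehlerKernel_right t z).measurable.ennreal_ofReal
              rw [lintegral_mul_const _ hKz, lintegral_mehlerKernel ht, one_mul]

lemma integrable_ornsteinUhlenbeck {t : ℝ} (ht : 0 < t) {f : EuclideanSpace ℝ (Fin d) → 𝕜}
    (hf : Integrable f (gaussianMeas d)) :
    Integrable (ornsteinUhlenbeck t f) (gaussianMeas d) :=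
  ⟨aestronglyMeasurable_ornsteinUhlenbeck t hf,
    (lintegral_enorm_ornsteinUhlenbeck_le ht hf).trans_lt hf.2⟩

/-! ### Kernel estimates near and far from the vertex of the cone. -/

lemma summable_exp_neg_sq_mul_pow (d : ℕ) :
    Summable fun k : ℕ => Real.exp (-(k : ℝ) ^ 2 / 2) * ((k : ℝ) + 1) ^ d := by
  -- The factor `e^{3/2}` comes from `(k - 1)² ≥ 0`, i.e. `-k²/2 ≤ 3/2 - (k + 1)`.
  have h := ((summable_nat_add_iff 1).2
    (Real.summable_pow_mul_exp_neg_nat_mul d one_pos)).mul_left (Real.exp (3 / 2))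
  refine h.of_nonneg_of_le (fun k => by positivity) fun k => ?_
  push_cast
  rw [mul_left_comm, mul_comm, ← Real.exp_add]
  gcongr
  nlinarith [sq_nonneg ((k : ℝ) - 1)]

/-- A Gaussian average of a function whose integrals over balls centred at `x` are controlled
by the volume of the balls. -/
lemma lintegral_exp_neg_sq_mul_le (x : EuclideanSpace ℝ (Fin d)) {h : ℝ} (hh : 0 < h)
    {g : EuclideanSpace ℝ (Fin d) → ℝ≥0∞} (hg : AEMeasurable g) {A : ℝ≥0∞}
    (hA : ∀ ρ : ℝ, 0 < ρ → ∫⁻ z in Metric.closedBall x ρ, g z ≤ A * ENNReal.ofReal (ρ ^ d)) :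
    ∫⁻ z, ENNReal.ofReal (Real.exp (-‖z - x‖ ^ 2 / (2 * h ^ 2))) * g z ≤
      A * ENNReal.ofReal (h ^ d) *
        ∑' k : ℕ, ENNReal.ofReal (Real.exp (-(k : ℝ) ^ 2 / 2) * ((k : ℝ) + 1) ^ d) := by
  have hpt : ∀ z, ENNReal.ofReal (Real.exp (-‖z - x‖ ^ 2 / (2 * h ^ 2))) * g z ≤
      ∑' k : ℕ, ENNReal.ofReal (Real.exp (-(k : ℝ) ^ 2 / 2)) *
        (Metric.closedBall x (((k : ℝ) + 1) * h)).indicator g z := by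
    intro z
    -- One term suffices: for `k = ⌊|z - x|/h⌋` the weight `e^{-k²/2}` already dominates and `z`
    -- lies in the ball of radius `(k + 1)h`.
    refine le_trans ?_ (ENNReal.le_tsum ⌊‖z - x‖ / h⌋₊)
    have h1 : (⌊‖z - x‖ / h⌋₊ : ℝ) ≤ ‖z - x‖ / h := Nat.floor_le (by positivity)
    have h2 : ‖z - x‖ / h < ⌊‖z - x‖ / h⌋₊ + 1 := Nat.lt_floor_add_one _
    have hz : z ∈ Metric.closedBall x (((⌊‖z - x‖ / h⌋₊ : ℝ) + 1) * h) := by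
      rw [mem_closedBall_iff_norm]
      exact ((div_lt_iff₀ hh).1 h2).le
    rw [Set.indicator_of_mem hz]
    have h3 : -‖z - x‖ ^ 2 / (2 * h ^ 2) = -(‖z - x‖ / h) ^ 2 / 2 := by field_simp
    rw [h3]
    gcongr
  calc _ ≤ ∫⁻ z, ∑' k : ℕ, ENNReal.ofReal (Real.exp (-(k : ℝ) ^ 2 / 2)) *
        (Metric.closedBall x (((k : ℝ) + 1) * h)).indicator g z := lintegral_mono hpt
    _ = ∑' k : ℕ, ENNReal.ofReal (Real.exp (-(k : ℝ) ^ 2 / 2)) *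
        ∫⁻ z in Metric.closedBall x (((k : ℝ) + 1) * h), g z := by
      rw [lintegral_tsum fun k =>
        (hg.indicator Metric.isClosed_closedBall.measurableSet).const_mul _]
      refine tsum_congr fun k => ?_
      rw [lintegral_const_mul' _ _ ENNReal.ofReal_ne_top,
        lintegral_indicator Metric.isClosed_closedBall.measurableSet]
    _ ≤ ∑' k : ℕ, A * ENNReal.ofReal (h ^ d) *
        ENNReal.ofReal (Real.exp (-(k : ℝ) ^ 2 / 2) * ((k : ℝ) + 1) ^ d) := by
      refine ENNReal.tsum_le_tsum fun k => ?_
      refine (mul_le_mul_right (hA _ (by positivity)) _).trans_eq ?_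
      rw [mul_pow, ENNReal.ofReal_mul (by positivity), ENNReal.ofReal_mul (by positivity)]
      ring
    _ = _ := ENNReal.tsum_mul_left

/-- The normalising constant of the Mehler kernel. -/
def mehlerConst (d : ℕ) (t : ℝ) : ℝ :=
  1 / (Real.pi ^ ((d : ℝ) / 2) * (1 - Real.exp (-2 * t)) ^ ((d : ℝ) / 2))

lemma mehlerConst_nonneg {t : ℝ} (ht : 0 < t) : 0 ≤ mehlerConst d t := by
  have := one_sub_exp_neg_two_mul_pos ht
  unfold mehlerConst; positivity

/-- With width `h = √(1 - e^{-2t})`, the volume factor `h^d` cancels the normalisation up to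
`π^{-d/2} ≤ 1`. -/
lemma mehlerConst_mul_sqrt_pow_le {t : ℝ} (ht : 0 < t) :
    mehlerConst d t * Real.sqrt (1 - Real.exp (-2 * t)) ^ d ≤ 1 := by
  have hs := one_sub_exp_neg_two_mul_pos ht
  have h : Real.sqrt (1 - Real.exp (-2 * t)) ^ d = (1 - Real.exp (-2 * t)) ^ ((d : ℝ) / 2) := by
    rw [Real.sqrt_eq_rpow, ← Real.rpow_natCast, ← Real.rpow_mul hs.le]
    congr 1; ring
  have h1 : 1 ≤ Real.pi ^ ((d : ℝ) / 2) :=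
    Real.one_le_rpow (by linarith [Real.pi_gt_three]) (by positivity)
  have h2 : 0 < (1 - Real.exp (-2 * t)) ^ ((d : ℝ) / 2) := by positivity
  rw [h, mehlerConst, one_div_mul_eq_div, div_le_one (by positivity)]
  exact le_mul_of_one_le_left h2.le h1

lemma le_one_sub_exp_neg_two_mul {t : ℝ} (ht : 0 < t) (ht' : t ≤ 1 / 2) :
    t ≤ 1 - Real.exp (-2 * t) := by
  have h1 : 2 * t + 1 ≤ Real.exp (2 * t) := Real.add_one_le_exp _
  have h2 : Real.exp (-2 * t) * Real.exp (2 * t) = 1 := by rw [← Real.exp_add]; simp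
  nlinarith [Real.exp_pos (-2 * t)]

/-- Near `x`, in a parabolic region, the Mehler kernel is dominated by a Gaussian centred at `x`. -/
lemma mehlerKernel_le_near {t : ℝ} (ht : 0 < t) (ht' : t ≤ 1 / 2)
    {x y : EuclideanSpace ℝ (Fin d)} (hy : ‖y - x‖ < Real.sqrt t) (hy' : ‖y - x‖ < 1)
    (z : EuclideanSpace ℝ (Fin d)) :
    mehlerKernel t y z ≤ Real.exp ((‖x‖ + 2) ^ 2) * mehlerConst d t *
      Real.exp (-‖z - x‖ ^ 2 / (2 * Real.sqrt (1 - Real.exp (-2 * t)) ^ 2)) := by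
  have hs := one_sub_exp_neg_two_mul_pos ht
  have hts := le_one_sub_exp_neg_two_mul ht ht'
  have ha : 1 - t ≤ Real.exp (-t) := by linarith [Real.add_one_le_exp (-t)]
  have ha1 : Real.exp (-t) ≤ 1 := Real.exp_le_one_iff.2 (by linarith)
  have hst : t ≤ Real.sqrt t := Real.le_sqrt_of_sq_le (by nlinarith)
  have hyn : ‖y‖ ≤ ‖x‖ + 1 := by
    have := norm_le_norm_add_norm_sub' y x
    linarith
  -- The drift contributes `(1 - e^{-t})|y| ≤ t(|x| + 1) ≤ √t(|x| + 1)`, and the cone one more `√t`.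
  have hd : ‖x - Real.exp (-t) • y‖ ≤ Real.sqrt t * (‖x‖ + 2) := by
    have h1 : x - Real.exp (-t) • y = (1 - Real.exp (-t)) • y - (y - x) := by
      rw [sub_smul, one_smul]; abel
    rw [h1]
    refine (norm_sub_le _ _).trans ?_
    rw [norm_smul, Real.norm_of_nonneg (by linarith)]
    have h2 : (1 - Real.exp (-t)) * ‖y‖ ≤ Real.sqrt t * (‖x‖ + 1) := by
      gcongr
      linarith
    linarith
  have hd2 : ‖x - Real.exp (-t) • y‖ ^ 2 ≤ (1 - Real.exp (-2 * t)) * (‖x‖ + 2) ^ 2 := by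
    calc _ ≤ (Real.sqrt t * (‖x‖ + 2)) ^ 2 := by gcongr
      _ = t * (‖x‖ + 2) ^ 2 := by rw [mul_pow, Real.sq_sqrt ht.le]
      _ ≤ _ := by gcongr
  -- Recentring costs a factor 2 in the variance, and the squared shift becomes the constant
  -- `e^{(|x| + 2)²}`.
  have htri : ‖z - x‖ ^ 2 ≤ 2 * ‖z - Real.exp (-t) • y‖ ^ 2 + 2 * ‖x - Real.exp (-t) • y‖ ^ 2 := by
    have h1 : ‖z - x‖ ≤ ‖z - Real.exp (-t) • y‖ + ‖x - Real.exp (-t) • y‖ := by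
      have := norm_sub_le (z - Real.exp (-t) • y) (x - Real.exp (-t) • y)
      rwa [sub_sub_sub_cancel_right] at this
    nlinarith [norm_nonneg (z - x), sq_nonneg (‖z - Real.exp (-t) • y‖ - ‖x - Real.exp (-t) • y‖)]
  rw [Real.sq_sqrt hs.le, mul_assoc, mul_left_comm, ← Real.exp_add]
  refine mul_le_mul_of_nonneg_left (Real.exp_le_exp.2 ?_) (mehlerConst_nonneg ht)
  generalize 1 - Real.exp (-2 * t) = s at *
  have e1 : -‖z - Real.exp (-t) • y‖ ^ 2 / s = -(2 * ‖z - Real.exp (-t) • y‖ ^ 2) / (2 * s) := by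
    field_simp
  have e2 : (‖x‖ + 2) ^ 2 + -‖z - x‖ ^ 2 / (2 * s) =
      (2 * (s * (‖x‖ + 2) ^ 2) - ‖z - x‖ ^ 2) / (2 * s) := by
    field_simp
    ring
  rw [e1, e2]
  gcongr
  linarith

lemma tendsto_one_sub_exp_neg_two_mul :
    Tendsto (fun t : ℝ => 1 - Real.exp (-2 * t)) (𝓝[>] 0) (𝓝[>] 0) := by
  refine tendsto_nhdsWithin_iff.2 ⟨?_, ?_⟩
  · have : Continuous fun t : ℝ => 1 - Real.exp (-2 * t) := by fun_prop
    simpa using (this.tendsto 0).mono_left nhdsWithin_le_nhds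
  · filter_upwards [self_mem_nhdsWithin] with t ht using one_sub_exp_neg_two_mul_pos ht

/-- In `u = 1/(1 - e^{-2t}) → ∞` this is the decay of `u^{d/2} e^{-bu}`. -/
lemma tendsto_mehlerConst_mul_exp {b : ℝ} (hb : 0 < b) :
    Tendsto (fun t : ℝ => mehlerConst d t * Real.exp (-b / (1 - Real.exp (-2 * t))))
      (𝓝[>] 0) (𝓝 0) := by
  have h := ((tendsto_rpow_mul_exp_neg_mul_atTop_nhds_zero ((d : ℝ) / 2) b hb).comp
    (tendsto_inv_nhdsGT_zero.comp tendsto_one_sub_exp_neg_two_mul)).const_mul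
      (1 / Real.pi ^ ((d : ℝ) / 2))
  rw [mul_zero] at h
  refine h.congr' ?_
  filter_upwards [self_mem_nhdsWithin] with t ht
  have hs := one_sub_exp_neg_two_mul_pos ht
  simp only [Function.comp_apply, mehlerConst]
  rw [Real.inv_rpow hs.le, div_eq_mul_inv (-b), one_div, one_div, mul_inv]
  ring

lemma eventually_mem_parabolicGaussianCone (x : EuclideanSpace ℝ (Fin d)) :
    ∀ᶠ p in 𝓝[parabolicGaussianCone x] (x, (0 : ℝ)), p ∈ parabolicGaussianCone x :=
  self_mem_nhdsWithin

lemma tendsto_snd_parabolicGaussianCone (x : EuclideanSpace ℝ (Fin d)) :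
    Tendsto Prod.snd (𝓝[parabolicGaussianCone x] (x, (0 : ℝ))) (𝓝[>] 0) := by
  refine tendsto_nhdsWithin_iff.2
    ⟨(continuous_snd.tendsto (x, (0 : ℝ))).mono_left nhdsWithin_le_nhds, ?_⟩
  filter_upwards [eventually_mem_parabolicGaussianCone x] with p hp using hp.1

/-- Away from `x`, the Mehler kernel tends to zero uniformly relative to the Gaussian density. -/
lemma eventually_mehlerKernel_le_far (x : EuclideanSpace ℝ (Fin d)) {δ ε : ℝ} (hδ : 0 < δ)
    (hε : 0 < ε) :
    ∀ᶠ p in 𝓝[parabolicGaussianCone x] (x, (0 : ℝ)), ∀ z, δ < ‖z - x‖ →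
      mehlerKernel p.2 p.1 z ≤ ε * gaussianDensity z := by
  -- This quantity bounds `|y - e^{-t}z|` below for all `z` with `|z - x| > δ` at once; its limit is
  -- `δ`, so it eventually exceeds `δ/2`.
  have hcont : Tendsto (fun p : EuclideanSpace ℝ (Fin d) × ℝ =>
      Real.exp (-p.2) * δ - ‖p.1 - Real.exp (-p.2) • x‖)
      (𝓝[parabolicGaussianCone x] (x, (0 : ℝ))) (𝓝 δ) := by
    have : Continuous fun p : EuclideanSpace ℝ (Fin d) × ℝ =>
      Real.exp (-p.2) * δ - ‖p.1 - Real.exp (-p.2) • x‖ := by fun_prop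
    simpa using (this.tendsto (x, (0 : ℝ))).mono_left nhdsWithin_le_nhds
  have hsmall := (((tendsto_mehlerConst_mul_exp (d := d) (b := (δ / 2) ^ 2) (by positivity)).comp
    (tendsto_snd_parabolicGaussianCone x)).const_mul
      (Real.exp ((‖x‖ + 1) ^ 2) * Real.pi ^ ((d : ℝ) / 2)))
  rw [mul_zero] at hsmall
  filter_upwards [eventually_mem_parabolicGaussianCone x,
    hcont.eventually (eventually_gt_nhds (half_lt_self hδ)),
    hsmall.eventually (eventually_lt_nhds hε)] with p hp h1 h2 z hz
  obtain ⟨y, t⟩ := p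
  simp only [Function.comp_apply] at h1 h2
  have ht : 0 < t := hp.1
  have hyx : ‖y - x‖ < 1 := hp.2.2.2
  have hs := one_sub_exp_neg_two_mul_pos ht
  have hyn : ‖y‖ ≤ ‖x‖ + 1 := by
    have := norm_le_norm_add_norm_sub' y x
    linarith
  have hdist : δ / 2 ≤ ‖y - Real.exp (-t) • z‖ := by
    have h3 : Real.exp (-t) * δ ≤ Real.exp (-t) * ‖z - x‖ := by gcongr
    have h4 : Real.exp (-t) * ‖z - x‖ = ‖Real.exp (-t) • (z - x)‖ := by
      rw [norm_smul, Real.norm_of_nonneg (Real.exp_pos _).le]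
    have h5 := norm_sub_le (y - Real.exp (-t) • x) (y - Real.exp (-t) • z)
    rw [sub_sub_sub_cancel_left, ← smul_sub] at h5
    linarith
  rw [mehlerKernel_eq_mul_exp ht]
  calc Real.exp (‖y‖ ^ 2) * Real.exp (-‖z‖ ^ 2) * mehlerKernel t z y
      ≤ Real.exp ((‖x‖ + 1) ^ 2) * Real.exp (-‖z‖ ^ 2) *
        (mehlerConst d t * Real.exp (-(δ / 2) ^ 2 / (1 - Real.exp (-2 * t)))) := by
        have h6 : mehlerKernel t z y ≤
            mehlerConst d t * Real.exp (-(δ / 2) ^ 2 / (1 - Real.exp (-2 * t))) := by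
          unfold mehlerKernel
          refine mul_le_mul_of_nonneg_left (Real.exp_le_exp.2 ?_) (mehlerConst_nonneg ht)
          gcongr
        have := mehlerKernel_nonneg ht z y
        gcongr
    _ = Real.exp ((‖x‖ + 1) ^ 2) * Real.pi ^ ((d : ℝ) / 2) *
        (mehlerConst d t * Real.exp (-(δ / 2) ^ 2 / (1 - Real.exp (-2 * t)))) *
          gaussianDensity z := by
        unfold gaussianDensity
        have : 0 < Real.pi ^ ((d : ℝ) / 2) := by positivity
        field_simp
    _ ≤ ε * gaussianDensity z := by
        have := gaussianDensity_pos z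
        gcongr

/-! ### Pointwise convergence. -/

/-- The Ornstein-Uhlenbeck semigroup converges non-tangentially at Lebesgue points. -/
lemma tendsto_ornsteinUhlenbeck_of_lebesguePoint {f : EuclideanSpace ℝ (Fin d) → 𝕜}
    (hf : Integrable f (gaussianMeas d)) {x : EuclideanSpace ℝ (Fin d)}
    (hx : Tendsto (fun r : ℝ => (∫⁻ z in Metric.closedBall x r, ‖f z - f x‖ₑ) /
      volume (Metric.closedBall x r)) (𝓝[>] 0) (𝓝 0)) :
    Tendsto (fun p : EuclideanSpace ℝ (Fin d) × ℝ => ornsteinUhlenbeck p.2 f p.1)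
      (𝓝[parabolicGaussianCone x] (x, 0)) (𝓝 (f x)) := by
  set V := volume (Metric.closedBall (0 : EuclideanSpace ℝ (Fin d)) 1)
  set S := ∑' k : ℕ, ENNReal.ofReal (Real.exp (-(k : ℝ) ^ 2 / 2) * ((k : ℝ) + 1) ^ d)
  set G := ∫⁻ z, ‖f z - f x‖ₑ ∂(gaussianMeas d)
  set C := Real.exp ((‖x‖ + 2) ^ 2)
  -- Near-part constant plus far-part constant; neither depends on `η`, `δ` or `t`.
  set M := ENNReal.ofReal C * V * S + G
  have hV : V ≠ ∞ := measure_closedBall_lt_top.ne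
  have hS : S ≠ ∞ := (summable_exp_neg_sq_mul_pow d).tsum_ofReal_ne_top
  have hgi : Integrable (fun z => f z - f x) (gaussianMeas d) := hf.sub (integrable_const _)
  have hG : G ≠ ∞ := hgi.2.ne
  have hM : M ≠ ∞ := by finiteness
  have hgm : AEMeasurable fun z => ‖f z - f x‖ₑ := (aestronglyMeasurable_volume hgi).enorm
  have key : ∀ η : ℝ, 0 < η → ∀ᶠ p in 𝓝[parabolicGaussianCone x] (x, (0 : ℝ)),
      ‖ornsteinUhlenbeck p.2 f p.1 - f x‖ₑ ≤ ENNReal.ofReal η * M := by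
    intro η hη
    have hev := hx.eventually (eventually_lt_nhds (ENNReal.ofReal_pos.2 hη))
    obtain ⟨δ, hδ, hδ'⟩ := mem_nhdsGT_iff_exists_Ioc_subset.1 hev
    simp only [Set.mem_Ioi] at hδ
    -- The Lebesgue-point bound is known only for radii up to `δ`; cutting the function off outside
    -- that ball extends it to all radii.
    have hball : ∀ ρ : ℝ, 0 < ρ →
        ∫⁻ z in Metric.closedBall x ρ, (Metric.closedBall x δ).indicator
          (fun z => ‖f z - f x‖ₑ) z ≤ ENNReal.ofReal η * V * ENNReal.ofReal (ρ ^ d) := by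
      intro ρ hρ
      have hm : 0 < min ρ δ := lt_min hρ hδ
      have h1 := hδ' ⟨hm, min_le_right ρ δ⟩
      simp only [Set.mem_ofPred_eq] at h1
      have h2 : ∫⁻ z in Metric.closedBall x (min ρ δ), ‖f z - f x‖ₑ ≤
          ENNReal.ofReal η * volume (Metric.closedBall x (min ρ δ)) := by
        refine (ENNReal.div_le_iff ?_ measure_closedBall_lt_top.ne).1 h1.le
        exact (Metric.measure_closedBall_pos _ _ hm).ne'
      rw [setLIntegral_indicator Metric.isClosed_closedBall.measurableSet]
      refine (lintegral_mono_set (t := Metric.closedBall x (min ρ δ)) ?_).trans (h2.trans ?_)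
      · rintro z ⟨hz1, hz2⟩
        exact Metric.mem_closedBall.2 (le_min hz2 hz1)
      · rw [Measure.addHaar_closedBall' _ _ hm.le, finrank_euclideanSpace_fin, mul_assoc,
          mul_comm V]
        gcongr
        exact min_le_left _ _
    have hsmall : ∀ᶠ p in 𝓝[parabolicGaussianCone x] (x, (0 : ℝ)), p.2 ≤ 1 / 2 :=
      ((tendsto_snd_parabolicGaussianCone x).mono_right nhdsWithin_le_nhds).eventually
        (eventually_le_nhds (by norm_num))
    filter_upwards [eventually_mem_parabolicGaussianCone x, hsmall,
      eventually_mehlerKernel_le_far x hδ hη] with p hp ht' hfar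
    obtain ⟨y, t⟩ := p
    simp only at ht' hfar ⊢
    have ht : 0 < t := hp.1
    have hs := one_sub_exp_neg_two_mul_pos ht
    have hsub : ornsteinUhlenbeck t f y - f x = ornsteinUhlenbeck t (fun z => f z - f x) y := by
      have := congrFun (ornsteinUhlenbeck_sub ht hf (integrable_const (f x))) y
      rw [Pi.sub_apply, ornsteinUhlenbeck_const ht] at this
      exact this.symm
    rw [hsub]
    refine (enorm_ornsteinUhlenbeck_le ht _ y).trans ?_
    have hnear : ∫⁻ z in Metric.closedBall x δ,
        ENNReal.ofReal (mehlerKernel t y z) * ‖f z - f x‖ₑ ≤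
        ENNReal.ofReal η * (ENNReal.ofReal C * V * S) := by
      calc _ ≤ ∫⁻ z in Metric.closedBall x δ, ENNReal.ofReal (C * mehlerConst d t) *
            (ENNReal.ofReal (Real.exp (-‖z - x‖ ^ 2 /
              (2 * Real.sqrt (1 - Real.exp (-2 * t)) ^ 2))) * ‖f z - f x‖ₑ) := by
            refine lintegral_mono fun z => ?_
            rw [← mul_assoc, ← ENNReal.ofReal_mul
              (mul_nonneg (Real.exp_pos _).le (mehlerConst_nonneg ht))]
            gcongr
            exact mehlerKernel_le_near ht ht' hp.2.1 hp.2.2.2 z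
        _ = ENNReal.ofReal (C * mehlerConst d t) * ∫⁻ z,
            ENNReal.ofReal (Real.exp (-‖z - x‖ ^ 2 /
              (2 * Real.sqrt (1 - Real.exp (-2 * t)) ^ 2))) *
              (Metric.closedBall x δ).indicator (fun z => ‖f z - f x‖ₑ) z := by
            rw [lintegral_const_mul' _ _ ENNReal.ofReal_ne_top,
              ← lintegral_indicator Metric.isClosed_closedBall.measurableSet]
            simp_rw [Set.indicator_mul_right]
        _ ≤ ENNReal.ofReal (C * mehlerConst d t) * (ENNReal.ofReal η * V *
            ENNReal.ofReal (Real.sqrt (1 - Real.exp (-2 * t)) ^ d) * S) := by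
            gcongr
            exact lintegral_exp_neg_sq_mul_le x (Real.sqrt_pos.2 hs)
              (hgm.indicator Metric.isClosed_closedBall.measurableSet) hball
        _ = ENNReal.ofReal (mehlerConst d t * Real.sqrt (1 - Real.exp (-2 * t)) ^ d) *
            (ENNReal.ofReal η * (ENNReal.ofReal C * V * S)) := by
            rw [ENNReal.ofReal_mul (Real.exp_pos _).le,
              ENNReal.ofReal_mul (mehlerConst_nonneg ht)]
            ring
        _ ≤ _ := by
            refine mul_le_of_le_one_left' ?_
            exact ENNReal.ofReal_le_one.2 (mehlerConst_mul_sqrt_pow_le ht)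
    have hfar' : ∫⁻ z in (Metric.closedBall x δ)ᶜ,
        ENNReal.ofReal (mehlerKernel t y z) * ‖f z - f x‖ₑ ≤ ENNReal.ofReal η * G := by
      calc _ ≤ ∫⁻ z in (Metric.closedBall x δ)ᶜ, ENNReal.ofReal η *
            (ENNReal.ofReal (gaussianDensity z) * ‖f z - f x‖ₑ) := by
            refine setLIntegral_mono' Metric.isClosed_closedBall.measurableSet.compl
              fun z hz => ?_
            rw [← mul_assoc, ← ENNReal.ofReal_mul hη.le]
            gcongr
            refine hfar z ?_
            simpa [dist_eq_norm] using hz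
        _ ≤ ∫⁻ z, ENNReal.ofReal η * (ENNReal.ofReal (gaussianDensity z) * ‖f z - f x‖ₑ) :=
            setLIntegral_le_lintegral _ _
        _ = _ := by
            rw [lintegral_const_mul' _ _ ENNReal.ofReal_ne_top, ← lintegral_gaussianMeas]
    rw [← lintegral_add_compl _ (Metric.isClosed_closedBall (x := x) (ε := δ)).measurableSet,
      mul_add]
    exact add_le_add hnear hfar'
  rw [Metric.tendsto_nhds]
  intro ε hε
  have hm : 0 ≤ M.toReal := ENNReal.toReal_nonneg
  filter_upwards [key (ε / (M.toReal + 1)) (by positivity)] with p hp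
  have hMη : ENNReal.ofReal (ε / (M.toReal + 1)) * M =
      ENNReal.ofReal (ε / (M.toReal + 1) * M.toReal) := by
    rw [ENNReal.ofReal_mul (by positivity), ENNReal.ofReal_toReal hM]
  rw [hMη, ← ofReal_norm, ENNReal.ofReal_le_ofReal_iff (by positivity)] at hp
  rw [dist_eq_norm]
  refine hp.trans_lt ?_
  rw [div_mul_eq_mul_div, div_lt_iff₀ (by positivity)]
  nlinarith

/-- Almost every point is a Lebesgue point; the Besicovitch family supplies averages over closed
balls centred at `x`. -/
lemma ae_tendsto_ornsteinUhlenbeck {f : EuclideanSpace ℝ (Fin d) → 𝕜}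
    (hf : Integrable f (gaussianMeas d)) :
    ∀ᵐ x ∂(gaussianMeas d),
      Tendsto (fun p : EuclideanSpace ℝ (Fin d) × ℝ => ornsteinUhlenbeck p.2 f p.1)
        (𝓝[parabolicGaussianCone x] (x, 0)) (𝓝 (f x)) := by
  refine gaussianMeas_absolutelyContinuous.ae_le ?_
  filter_upwards [(Besicovitch.vitaliFamily volume).ae_tendsto_lintegral_enorm_sub_div
    (locallyIntegrable_of_integrable_gaussianMeas hf)] with x hx
  exact tendsto_ornsteinUhlenbeck_of_lebesguePoint hf
    (hx.comp (Besicovitch.tendsto_filterAt volume x))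

lemma tendsto_vertical_parabolicGaussianCone (x : EuclideanSpace ℝ (Fin d)) :
    Tendsto (fun t : ℝ => (x, t)) (𝓝[>] 0) (𝓝[parabolicGaussianCone x] (x, 0)) := by
  refine tendsto_nhdsWithin_iff.2 ⟨?_, ?_⟩
  · exact ((by fun_prop : Continuous fun t : ℝ => (x, t)).tendsto 0).mono_left nhdsWithin_le_nhds
  · filter_upwards [self_mem_nhdsWithin] with t ht
    have ht' : 0 < t := ht
    simp [parabolicGaussianCone, ht']

lemma ae_tendsto_ornsteinUhlenbeck_vertical {f : EuclideanSpace ℝ (Fin d) → 𝕜}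
    (hf : Integrable f (gaussianMeas d)) :
    ∀ᵐ x ∂(gaussianMeas d),
      Tendsto (fun t : ℝ => ornsteinUhlenbeck t f x) (𝓝[>] 0) (𝓝 (f x)) := by
  filter_upwards [ae_tendsto_ornsteinUhlenbeck hf] with x hx
  have h := Tendsto.comp hx (tendsto_vertical_parabolicGaussianCone x)
  simpa only [Function.comp_def] using h

/-! ### Convergence in `L¹(γ_d)`. -/

/-- The kernel has mass 1, so `|T_t g| ≤ B`, and the constant `2B` is an integrable majorant because
`γ_d` is finite. -/
lemma tendsto_eLpNorm_ornsteinUhlenbeck_sub_of_bounded {g : EuclideanSpace ℝ (Fin d) → 𝕜}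
    (hg : Integrable g (gaussianMeas d)) {B : ℝ} (hB : ∀ x, ‖g x‖ ≤ B) :
    Tendsto (fun t : ℝ => eLpNorm (ornsteinUhlenbeck t g - g) 1 (gaussianMeas d))
      (𝓝[>] 0) (𝓝 0) := by
  simp only [eLpNorm_one_eq_lintegral_enorm, Pi.sub_apply]
  have hB' : ∀ x, ‖g x‖ₑ ≤ ENNReal.ofReal B := fun x => by
    rw [← ofReal_norm]; exact ENNReal.ofReal_le_ofReal (hB x)
  rw [← lintegral_zero (μ := gaussianMeas d)]
  refine tendsto_lintegral_filter_of_dominated_convergence'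
    (fun _ => ENNReal.ofReal B + ENNReal.ofReal B) ?_ ?_ (by simp [ENNReal.ofReal_ne_top]) ?_
  · exact Eventually.of_forall fun t =>
      ((aestronglyMeasurable_ornsteinUhlenbeck t hg).sub hg.1).enorm
  · filter_upwards [self_mem_nhdsWithin] with t ht
    refine ae_of_all _ fun x => (enorm_sub_le).trans (add_le_add ?_ (hB' x))
    refine (enorm_ornsteinUhlenbeck_le ht g x).trans ?_
    calc _ ≤ ∫⁻ z, ENNReal.ofReal (mehlerKernel t x z) * ENNReal.ofReal B :=
          lintegral_mono fun z => by gcongr; exact hB' z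
      _ = _ := by
          rw [lintegral_mul_const' _ _ ENNReal.ofReal_ne_top, lintegral_mehlerKernel ht, one_mul]
  · filter_upwards [ae_tendsto_ornsteinUhlenbeck_vertical hg] with x hx
    have := (hx.sub_const (g x)).enorm
    simpa using this

lemma tendsto_eLpNorm_ornsteinUhlenbeck_sub {f : EuclideanSpace ℝ (Fin d) → 𝕜}
    (hf : Integrable f (gaussianMeas d)) :
    Tendsto (fun t : ℝ => eLpNorm (ornsteinUhlenbeck t f - f) 1 (gaussianMeas d))
      (𝓝[>] 0) (𝓝 0) := by
  rw [ENNReal.tendsto_nhds_zero]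
  intro ε hε
  have hε3 : ε / 3 ≠ 0 := (ENNReal.div_pos hε.ne' (by norm_num)).ne'
  obtain ⟨g, B, hfg, hgi, hB⟩ : ∃ (g : EuclideanSpace ℝ (Fin d) → 𝕜) (B : ℝ),
      eLpNorm (f - g) 1 (gaussianMeas d) ≤ ε / 3 ∧ Integrable g (gaussianMeas d) ∧
        ∀ x, ‖g x‖ ≤ B := by
    obtain ⟨g, hfg, hg⟩ :=
      (memLp_one_iff_integrable.2 hf).exists_boundedContinuous_eLpNorm_sub_le
        ENNReal.one_ne_top hε3
    exact ⟨g, ‖g‖, hfg, memLp_one_iff_integrable.1 hg, g.norm_coe_le_norm⟩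
  have hlim := tendsto_eLpNorm_ornsteinUhlenbeck_sub_of_bounded hgi hB
  filter_upwards [self_mem_nhdsWithin, (ENNReal.tendsto_nhds_zero.1 hlim) _ hε3.bot_lt] with t ht h1
  -- Three errors of `ε/3`: contractivity controls the first uniformly in `t`, the bounded case the
  -- second, the choice of `g` the third.
  have hdecomp : ornsteinUhlenbeck t f - f =
      ornsteinUhlenbeck t (f - g) + (ornsteinUhlenbeck t g - g) + (g - f) := by
    rw [ornsteinUhlenbeck_sub ht hf hgi]; abel
  have hm1 := aestronglyMeasurable_ornsteinUhlenbeck t (hf.sub hgi)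
  have hm2 := (aestronglyMeasurable_ornsteinUhlenbeck t hgi).sub hgi.1
  have h2 : eLpNorm (ornsteinUhlenbeck t (f - g)) 1 (gaussianMeas d) ≤ ε / 3 := by
    refine le_trans ?_ hfg
    rw [eLpNorm_one_eq_lintegral_enorm, eLpNorm_one_eq_lintegral_enorm]
    exact lintegral_enorm_ornsteinUhlenbeck_le ht (hf.sub hgi)
  have h3 : eLpNorm (g - f) 1 (gaussianMeas d) ≤ ε / 3 := by
    rwa [eLpNorm_sub_comm]
  rw [hdecomp]
  calc _ ≤ ε / 3 + ε / 3 + ε / 3 :=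
        (eLpNorm_add_le (hm1.add hm2) (hgi.1.sub hf.1) le_rfl).trans
          (add_le_add ((eLpNorm_add_le hm1 hm2 le_rfl).trans (add_le_add h2 h1)) h3)
    _ = ε := ENNReal.add_thirds ε

end

theorem mainTheorem2 {𝕜 : Type*} [RCLike 𝕜] (d : ℕ) (f : EuclideanSpace ℝ (Fin d) → 𝕜)
    (hf : Integrable f (gaussianMeas d)) :
    -- convergence in `L¹(γ_d)` as `t → 0⁺`
    ((∀ t : ℝ, 0 < t → Integrable (ornsteinUhlenbeck t f) (gaussianMeas d)) ∧
      Tendsto (fun t : ℝ => eLpNorm (ornsteinUhlenbeck t f - f) 1 (gaussianMeas d))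
        (𝓝[>] 0) (𝓝 0)) ∧
    -- convergence almost everywhere as `t → 0⁺`
    (∀ᵐ x ∂(gaussianMeas d),
      Tendsto (fun t : ℝ => ornsteinUhlenbeck t f x) (𝓝[>] 0) (𝓝 (f x))) ∧
    -- non-tangential convergence almost everywhere
    (∀ᵐ x ∂(gaussianMeas d),
      Tendsto (fun p : EuclideanSpace ℝ (Fin d) × ℝ => ornsteinUhlenbeck p.2 f p.1)
        (𝓝[parabolicGaussianCone x] (x, 0)) (𝓝 (f x))) := by
  exact ⟨⟨fun _ ht => integrable_ornsteinUhlenbeck ht hf,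
    tendsto_eLpNorm_ornsteinUhlenbeck_sub hf⟩, ae_tendsto_ornsteinUhlenbeck_vertical hf,
    ae_tendsto_ornsteinUhlenbeck hf⟩
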